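/- Let $n\in\{3,4\}$ and let $X_1,\dots,X_n$ be discrete random variables with $r_1,\dots,r_n$ states, where every $r_i\in\{2,3\}$ and at least one $r_i$ equals $2$ (all variables binary, or binary and ternary mixed). Let $\mathbb{R}[P_n]$ be the polynomial ring in the joint probabilities $p_x$, $x\in\prod_i[r_i]$. For pairwise disjoint $A,B,C\subseteq[n]$ with $A,B\ne\emptyset$, the CI ideal $I_{A\perp B|C}\subseteq\mathbb{R}[P_n]$ is generated by all $p_{abc+}\,p_{a'b'c+}-p_{ab'c+}\,p_{a'bc+}$, where $a,a'$; $b,b'$; $c$ are joint states of $A$; $B$; $C$ and $+$ denotes summation over the states of the remaining variables. The imset of $A\perp B|C$ is $e_{A\cup B\cup C}+e_C-e_{A\cup C}-e_{B\cup C}\in\mathbb{Z}^{2^{[n]}}$, and the statement is elementary if $|A|=|B|=1$. Suppose that the elementary statements $i_{1}\perp j_{1}|K_{1},\dots,i_{q}\perp j_{q}|K_{q}$ and $i'_{1}\perp j'_{1}|K'_{1},\dots,i'_{t}\perp j'_{t}|K'_{t}$ and the non-elementary statement $s$ form a three-sided CI relation, i.e. the imsets of the first collection and the imsets of the second collection both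 sum to the imset of $s$. Put $$J_1=\sum_{m=1}^{q}I_{i_m\perp j_m|K_m},\qquad J_2=\sum_{m=1}^{t}I_{i'_m\perp j'_m|K'_m},\qquad J_3=I_s .$$ Then $J_3$ is a minimal prime of $J_1$ and a minimal prime of $J_2$. Moreover, the variety $V(J_3)$ contains a point of the probability simplex that is not on its boundary (a strictly positive distribution), and it is the only component with this property: for every minimal prime $P\neq J_3$ of $J_1$ or of $J_2$, $V(P)$ meets the probability simplex at most in its boundary. -/

import Mathlib

/-- A conditional independence statement `A ⊥ B | C` about random variables indexed by
`Fin n`: three pairwise disjoint sets of indices, the first two of them nonempty. -/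
structure CIStatement (n : ℕ) where
  A : Finset (Fin n)
  B : Finset (Fin n)
  C : Finset (Fin n)
  nonempty_A : A.Nonempty
  nonempty_B : B.Nonempty
  disjoint_AB : Disjoint A B
  disjoint_AC : Disjoint A C
  disjoint_BC : Disjoint B C

/-- The statement is elementary: it has the form `i ⊥ j | C` with single indices `i`, `j`. -/
def CIStatement.IsElementary {n : ℕ} (s : CIStatement n) : Prop :=
  s.A.card = 1 ∧ s.B.card = 1

/-- The imset `e_{ABC} + e_C - e_{AC} - e_{BC}` in `ℤ^{2^n}` of the statement `A ⊥ B | C`. -/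
def CIStatement.imset {n : ℕ} (s : CIStatement n) : Finset (Fin n) → ℤ :=
  fun T => (if T = s.A ∪ s.B ∪ s.C then 1 else 0) + (if T = s.C then 1 else 0)
    - (if T = s.A ∪ s.C then 1 else 0) - (if T = s.B ∪ s.C then 1 else 0)

/-- A three-sided CI relation: the imsets of two collections of elementary statements have the
same sum, and this sum is the imset of the non-elementary statement `s`. -/
structure IsThreeSidedCIRelation {n : ℕ} (L₁ L₂ : Multiset (CIStatement n))
    (s : CIStatement n) : Prop where
  elementary_left : ∀ t ∈ L₁, t.IsElementary
  elementary_right : ∀ t ∈ L₂, t.IsElementary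
  not_elementary : ¬ s.IsElementary
  sum_left : (L₁.map CIStatement.imset).sum = s.imset
  sum_right : (L₂.map CIStatement.imset).sum = s.imset

/-- The joint states of `n` random variables, the `i`-th of which has `r i` states. -/
abbrev JointState {n : ℕ} (r : Fin n → ℕ) : Type := (i : Fin n) → Fin (r i)

/-- The polynomial ring over `ℝ` in the joint probabilities `p_x`, one for each joint state. -/
abbrev ProbRing {n : ℕ} (r : Fin n → ℕ) : Type := MvPolynomial (JointState r) ℝ

/-- The marginal probability `p_{x_S +}` as a linear form: the sum of all `p_y` such that
`y` agrees with `x` on `S`. -/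
noncomputable def marginal {n : ℕ} (r : Fin n → ℕ) (S : Finset (Fin n)) (x : JointState r) :
    ProbRing r :=
  ∑ y : JointState r with ∀ i ∈ S, y i = x i, MvPolynomial.X y

/-- The CI ideal of `A ⊥ B | C`, generated by the `2 × 2` minors
`p_{abc+} p_{a'b'c+} - p_{ab'c+} p_{a'bc+}`. Here `x` restricts to `(a, b, c)` and `y` to
`(a', b', c)`; replacing the `B`-coordinates of `x` by those of `y` gives `(a, b', c)`, and
conversely. The coordinates outside `A ∪ B ∪ C` do not matter. -/
noncomputable def ciIdeal {n : ℕ} (r : Fin n → ℕ) (s : CIStatement n) : Ideal (ProbRing r) :=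
  Ideal.span {f | ∃ x y : JointState r, (∀ i ∈ s.C, x i = y i) ∧
    f = marginal r (s.A ∪ s.B ∪ s.C) x * marginal r (s.A ∪ s.B ∪ s.C) y
      - marginal r (s.A ∪ s.B ∪ s.C) (s.B.piecewise y x)
        * marginal r (s.A ∪ s.B ∪ s.C) (s.B.piecewise x y)}

/-- The CI ideal of a finite collection of statements: the sum of their CI ideals. -/
noncomputable def ciIdealSum {n : ℕ} (r : Fin n → ℕ) (L : Multiset (CIStatement n)) :
    Ideal (ProbRing r) :=
  (L.map (ciIdeal r)).sum

/-- A set of points meets the probability simplex nontrivially if it contains a point of the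
simplex that is not on its boundary, that is, a strictly positive probability distribution. -/
def MeetsSimplexNontrivially {σ : Type*} [Fintype σ] (V : Set (σ → ℝ)) : Prop :=
  ∃ p ∈ V, p ∈ stdSimplex ℝ σ ∧ ∀ x, 0 < p x

open MvPolynomial

/-! Three facts about CI ideals give everything. (1) A set function with nonnegative pairing against
elementary imsets and zero pairing against the imset of `s` pairs to zero with every summand.
Suitable choices force each summand to follow from `s` by decomposition and weak union, so `J₁, J₂ ≤
J₃` (`elementary_summand_support`, `ciIdealSum_le_ciIdeal`). (2) `J₃` is prime: with marginals as
coordinates it is the kernel of a Segre map (`ciIdeal_isPrime`). (3) Modulo a prime containing no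
marginal, each summand says that an alternating product of marginals is 1. Multiplying these along
the imset identity gives the same for `s`, so a prime over `J₁` or `J₂` without marginals contains
`J₃` (`ciIdeal_le_of_isPrime`). Marginals are positive at a strictly positive point, so a prime
vanishing there contains none. The uniform distribution lies in `V(J₃)`, so (3) applies to primes
below `J₃`, giving minimality, and to any minimal prime meeting the open simplex, giving uniqueness.
-/

/-! ### Kernels of Segre-type monomial maps. -/

theorem prod_X_sub_prod_X_mem_of_swap {k σ τ : Type*} [CommRing k] {α β : σ → τ}
    {I : Ideal (MvPolynomial σ k)}
    (hinj : ∀ x y, α x = α y → β x = β y → x = y)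
    (hswap : ∀ x y z, α y = α x → β z = β x →
      ∃ w, α w = α z ∧ β w = β y ∧ (X y * X z - X x * X w : MvPolynomial σ k) ∈ I)
    (M : Multiset σ) : ∀ M' : Multiset σ, M.map α = M'.map α → M.map β = M'.map β →
      ((M.map X).prod - (M'.map X).prod : MvPolynomial σ k) ∈ I := by
  classical
  induction M using Multiset.induction with
  | empty =>
    intro M' hα _
    have : M' = 0 := by simpa [eq_comm] using hα
    simp [this]
  | cons x M ih =>
    intro M' hα hβ
    obtain ⟨y, hyM, hy⟩ := Multiset.mem_map.1
      (show α x ∈ M'.map α by rw [← hα]; simp)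
    obtain ⟨z, hzM, hz⟩ := Multiset.mem_map.1
      (show β x ∈ M'.map β by rw [← hβ]; simp)
    obtain ⟨M₁, rfl⟩ := Multiset.exists_cons_of_mem hyM
    by_cases hyz : z = y
    · subst hyz
      obtain rfl := hinj _ _ hy hz
      simp only [Multiset.map_cons, Multiset.cons_inj_right] at hα hβ
      simp only [Multiset.map_cons, Multiset.prod_cons, ← mul_sub]
      exact I.mul_mem_left _ (ih _ hα hβ)
    -- Modulo `I`, replace `X y * X z` by `X x * X w`: this creates a factor `X x` in the second
    -- monomial, which is then cancelled against the first.
    · have hzM₁ : z ∈ M₁ := (Multiset.mem_cons.1 hzM).resolve_left hyz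
      obtain ⟨M₂, rfl⟩ := Multiset.exists_cons_of_mem hzM₁
      obtain ⟨w, hwα, hwβ, hw⟩ := hswap x y z hy hz
      have h₁ : M.map α = (w ::ₘ M₂).map α := by
        simpa [hy, hwα] using hα
      have h₂ : M.map β = (w ::ₘ M₂).map β := by
        rw [Multiset.map_cons, Multiset.map_cons, Multiset.map_cons, Multiset.cons_swap, hz] at hβ
        simpa [hwβ] using hβ
      have key := I.sub_mem (I.mul_mem_left (X x) (ih _ h₁ h₂))
        (I.mul_mem_right (M₂.map X).prod hw)
      convert key using 1
      simp only [Multiset.map_cons, Multiset.prod_cons]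
      ring

/-- Monomials with equal image are congruent modulo `I`, so the quotient map by `I` factors linearly
through the monomial map. -/
theorem ker_segre_le_of_swap {k σ τ : Type*} [CommRing k] {α β : σ → τ}
    {I : Ideal (MvPolynomial σ k)}
    (hinj : ∀ x y, α x = α y → β x = β y → x = y)
    (hswap : ∀ x y z, α y = α x → β z = β x →
      ∃ w, α w = α z ∧ β w = β y ∧ (X y * X z - X x * X w : MvPolynomial σ k) ∈ I)
    {f : MvPolynomial σ k}
    (hf : aeval (fun y => (X (Sum.inl (α y)) * X (Sum.inr (β y)) : MvPolynomial (τ ⊕ τ) k)) f = 0) :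
    f ∈ I := by
  classical
  let W : (σ →₀ ℕ) → (τ ⊕ τ →₀ ℕ) := fun d =>
    d.mapDomain (fun y => Sum.inl (α y)) + d.mapDomain (fun y => Sum.inr (β y))
  have hW : ∀ d d', W d = W d' → (monomial d 1 - monomial d' 1 : MvPolynomial σ k) ∈ I := by
    intro d d' h
    have e (d : σ →₀ ℕ) : (W d).toMultiset =
        (d.toMultiset.map α).map Sum.inl + (d.toMultiset.map β).map Sum.inr := by
      rw [Multiset.map_map, Multiset.map_map, map_add, Finsupp.toMultiset_map,
        Finsupp.toMultiset_map]
      rfl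
    have h' := congrArg Finsupp.toMultiset h
    rw [e, e] at h'
    have hnone (M : Multiset σ) : M.filterMap (fun _ => (none : Option τ)) = 0 := by
      induction M using Multiset.induction <;> simp_all
    have hsome (g : σ → τ) (M : Multiset σ) : M.filterMap (fun x => some (g x)) = M.map g :=
      congrFun (Multiset.filterMap_eq_map g) M
    have hl : d.toMultiset.map α = d'.toMultiset.map α := by
      have := congrArg (Multiset.filterMap Sum.getLeft?) h'
      simpa [Multiset.filterMap_add, Multiset.filterMap_map, Function.comp_def, hnone, hsome] using this
    have hr : d.toMultiset.map β = d'.toMultiset.map β := by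
      have := congrArg (Multiset.filterMap Sum.getRight?) h'
      simpa [Multiset.filterMap_add, Multiset.filterMap_map, Function.comp_def, hnone, hsome] using this
    have key := prod_X_sub_prod_X_mem_of_swap hinj hswap _ _ hl hr
    have hm (d : σ →₀ ℕ) : ((d.toMultiset.map X).prod : MvPolynomial σ k) = monomial d 1 := by
      rw [Finsupp.toMultiset_map, Finsupp.prod_toMultiset, monomial_eq, Finsupp.prod_mapDomain_index]
        <;> simp [pow_add]
    rwa [hm, hm] at key
  let θ : MvPolynomial σ k →ₐ[k] MvPolynomial (τ ⊕ τ) k :=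
    aeval (fun y => X (Sum.inl (α y)) * X (Sum.inr (β y)))
  have hθ (d : σ →₀ ℕ) : θ (monomial d 1) = monomial (W d) 1 := by
    simp only [θ, W, aeval_monomial, map_one, one_mul, mul_pow, Finsupp.prod_mul]
    rw [← one_mul (1 : k), ← monomial_mul, monomial_eq, monomial_eq,
      Finsupp.prod_mapDomain_index (by simp) (by simp [pow_add]),
      Finsupp.prod_mapDomain_index (by simp) (by simp [pow_add])]
    simp
  -- A monomial goes to the class of some preimage monomial. The choice is immaterial by `hW`, and
  -- the values off the range of `W` play no role.
  let L : MvPolynomial (τ ⊕ τ) k →ₗ[k] (MvPolynomial σ k ⧸ I) :=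
    (basisMonomials (τ ⊕ τ) k).constr k
      (fun w => Ideal.Quotient.mk I (monomial (Function.invFun W w) 1))
  have hL : L ∘ₗ θ.toLinearMap = (Ideal.Quotient.mkₐ k I).toLinearMap := by
    refine (basisMonomials σ k).ext fun d => ?_
    have h : L (monomial (W d) 1) =
        Ideal.Quotient.mk I (monomial (Function.invFun W (W d)) 1) := by
      have := (basisMonomials (τ ⊕ τ) k).constr_basis k
        (fun w => Ideal.Quotient.mk I (monomial (Function.invFun W w) 1)) (W d)
      rwa [coe_basisMonomials] at this
    simp only [coe_basisMonomials, LinearMap.comp_apply, AlgHom.toLinearMap_apply, hθ, h,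
      Ideal.Quotient.mkₐ_eq_mk]
    exact Ideal.Quotient.eq.2 (hW _ _ (Function.invFun_eq ⟨d, rfl⟩))
  have := LinearMap.congr_fun hL f
  simp only [LinearMap.comp_apply, AlgHom.toLinearMap_apply, Ideal.Quotient.mkₐ_eq_mk] at this
  rw [show θ f = 0 from hf, map_zero] at this
  exact Ideal.Quotient.eq_zero_iff_mem.1 this.symm

/-! ### Imsets: which elementary statements can occur in a decomposition. -/

theorem imset_pairing {n : ℕ} (m : Finset (Fin n) → ℤ) (s : CIStatement n) :
    ∑ T, m T * s.imset T =
      m (s.A ∪ s.B ∪ s.C) + m s.C - m (s.A ∪ s.C) - m (s.B ∪ s.C) := by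
  simp [CIStatement.imset, mul_add, mul_sub, Finset.sum_add_distrib]

theorem pairing_multiset_sum {n : ℕ} (m : Finset (Fin n) → ℤ) (L : Multiset (CIStatement n)) :
    ∑ T, m T * (L.map CIStatement.imset).sum T =
      (L.map fun t => ∑ T, m T * t.imset T).sum := by
  induction L using Multiset.induction with
  | empty => simp
  | cons t L ih => simp [mul_add, Finset.sum_add_distrib, ih]

/-- A functional that is nonnegative on elementary imsets and vanishes on the imset of `s`
vanishes on every summand of a decomposition of the latter into elementary imsets. -/
theorem pairing_eq_zero {n : ℕ} {L : Multiset (CIStatement n)} {s : CIStatement n}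
    (hL : ∀ t ∈ L, t.IsElementary) (hsum : (L.map CIStatement.imset).sum = s.imset)
    (m : Finset (Fin n) → ℤ)
    (hm : ∀ i j : Fin n, ∀ K : Finset (Fin n), i ≠ j → i ∉ K → j ∉ K →
      0 ≤ m (insert i (insert j K)) + m K - m (insert i K) - m (insert j K))
    (hs : m (s.A ∪ s.B ∪ s.C) + m s.C - m (s.A ∪ s.C) - m (s.B ∪ s.C) = 0)
    {t : CIStatement n} (ht : t ∈ L) {i j : Fin n} (hi : t.A = {i}) (hj : t.B = {j}) :
    m (insert i (insert j t.C)) + m t.C - m (insert i t.C) - m (insert j t.C) = 0 := by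
  have hpos : ∀ t ∈ L, 0 ≤ ∑ T, m T * t.imset T := by
    intro t ht
    obtain ⟨i, hi⟩ := Finset.card_eq_one.1 (hL t ht).1
    obtain ⟨j, hj⟩ := Finset.card_eq_one.1 (hL t ht).2
    have h₁ := t.disjoint_AB
    have h₂ := t.disjoint_AC
    have h₃ := t.disjoint_BC
    rw [imset_pairing]
    simp only [hi, hj, Finset.disjoint_singleton_left, Finset.mem_singleton] at h₁ h₂ h₃ ⊢
    simpa only [Finset.insert_eq, Finset.union_assoc] using hm i j t.C h₁ h₂ h₃
  have h0 : (L.map fun t => ∑ T, m T * t.imset T).sum = 0 := by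
    rw [← pairing_multiset_sum, hsum, imset_pairing, hs]
  have := Multiset.all_zero_of_le_zero_le_of_sum_eq_zero
    (s := L.map fun t => ∑ T, m T * t.imset T) (by simpa using hpos) h0
    _ (Multiset.mem_map_of_mem (fun t => ∑ T, m T * t.imset T) ht)
  rw [imset_pairing, hi, hj] at this
  simpa only [Finset.insert_eq, Finset.union_assoc] using this

/-- Second difference of the square function. It makes `T ↦ |T ∩ D|²` supermodular and sensitive
exactly to pairs inside `D`; it is used with `D = s.A` and `D = s.B`. -/
theorem sq_card_inter_second_difference {n : ℕ} (D : Finset (Fin n)) {i j : Fin n}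
    {K : Finset (Fin n)} (hij : i ≠ j) (hi : i ∉ K) (hj : j ∉ K) :
    (((insert i (insert j K)) ∩ D).card : ℤ) ^ 2 + ((K ∩ D).card : ℤ) ^ 2
      - ((insert i K ∩ D).card : ℤ) ^ 2 - ((insert j K ∩ D).card : ℤ) ^ 2
      = if i ∈ D ∧ j ∈ D then 2 else 0 := by
  by_cases h₁ : i ∈ D <;> by_cases h₂ : j ∈ D <;>
    simp [Finset.insert_inter_of_mem, Finset.insert_inter_of_notMem, h₁, h₂, hij, hi, hj]
  all_goals ring

/-- Removes truncated subtraction, so that the weights `3 ^ (n - |T|)` become multiples of one power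
`3 ^ a`. -/
theorem exists_card_eq {n : ℕ} {i j : Fin n} {K : Finset (Fin n)} (hij : i ≠ j) (hi : i ∉ K)
    (hj : j ∉ K) : ∃ a, n - K.card = a + 2 ∧ n - (insert i K).card = a + 1 ∧
      n - (insert j K).card = a + 1 ∧ n - (insert i (insert j K)).card = a := by
  have h : (insert i (insert j K)).card ≤ n := by
    simpa using Finset.card_le_univ (insert i (insert j K))
  have e : (insert i (insert j K)).card = K.card + 2 := by
    rw [Finset.card_insert_of_notMem (by simp [hij, hi]), Finset.card_insert_of_notMem hj]
  rw [Finset.card_insert_of_notMem hi, Finset.card_insert_of_notMem hj, e]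
  exact ⟨n - K.card - 2, by omega, by omega, by omega, by omega⟩

theorem elementary_summand_support {n : ℕ} {L : Multiset (CIStatement n)} {s : CIStatement n}
    (hL : ∀ t ∈ L, t.IsElementary) (hsum : (L.map CIStatement.imset).sum = s.imset)
    {t : CIStatement n} (ht : t ∈ L) {i j : Fin n} (hi : t.A = {i}) (hj : t.B = {j}) :
    s.C ⊆ t.C ∧ insert i (insert j t.C) ⊆ s.A ∪ s.B ∪ s.C ∧
      (i ∈ s.A ∧ j ∈ s.B ∨ i ∈ s.B ∧ j ∈ s.A) := by
  have hij : i ≠ j := by simpa [hi, hj] using t.disjoint_AB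
  have hiK : i ∉ t.C := by simpa [hi] using t.disjoint_AC
  have hjK : j ∉ t.C := by simpa [hj] using t.disjoint_BC
  have hAB := s.disjoint_AB
  have hAC := s.disjoint_AC
  have hBC := s.disjoint_BC
  have hup : insert i (insert j t.C) ⊆ s.A ∪ s.B ∪ s.C := by
    set U := s.A ∪ s.B ∪ s.C with hU
    -- The second difference is positive unless `i`, `j` and `K` all lie in `U`. Base 2 would not
    -- do: for `K ⊆ U` and `i, j ∉ U` it gives `4 - 2 - 2 = 0`.
    have key := pairing_eq_zero hL hsum (fun T => if T ⊆ U then 0 else 3 ^ T.card)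
      (by
        intro i j K hij hi hj
        have hp : (0 : ℤ) < 3 ^ K.card := by positivity
        by_cases h₁ : i ∈ U <;> by_cases h₂ : j ∈ U <;> by_cases h₃ : K ⊆ U <;>
          simp [Finset.insert_subset_iff, h₁, h₂, h₃, hij, hi, hj, pow_succ] <;> linarith)
      (by
        have h₁ : s.C ⊆ U := by grind
        have h₂ : s.A ∪ s.C ⊆ U := by grind
        have h₃ : s.B ∪ s.C ⊆ U := by grind
        simp only [← hU, h₁, h₂, h₃, subset_refl, if_true]
        norm_num) ht hi hj
    have hp : (0 : ℤ) < 3 ^ t.C.card := by positivity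
    by_contra hc
    by_cases h₁ : i ∈ U <;> by_cases h₂ : j ∈ U <;> by_cases h₃ : t.C ⊆ U <;>
      simp [Finset.insert_subset_iff, h₁, h₂, h₃, hij, hiK, hjK, pow_succ] at key hc <;> linarith
  have hlow : s.C ⊆ t.C := by
    intro c hc
    -- Dual weight, decreasing in the size of `T`: its second difference is positive as soon as `c ∉
    -- K`.
    have key := pairing_eq_zero hL hsum (fun T => if c ∈ T then 0 else 3 ^ (n - T.card))
      (by
        intro i j K hij hi hj
        obtain ⟨a, e₀, e₁, e₂, e₃⟩ := exists_card_eq hij hi hj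
        by_cases h₁ : c = i <;> by_cases h₂ : c = j <;> by_cases h₃ : c ∈ K <;>
          simp_all [pow_succ, -Finset.card_insert_of_notMem]
        all_goals linarith [show (0 : ℤ) < 3 ^ a by positivity])
      (by
        simp only [Finset.mem_union, hc, or_true, if_true]
        norm_num) ht hi hj
    obtain ⟨a, e₀, e₁, e₂, e₃⟩ := exists_card_eq hij hiK hjK
    by_contra h₃
    by_cases h₁ : c = i <;> by_cases h₂ : c = j <;>
      simp_all [pow_succ, -Finset.card_insert_of_notMem] <;>
        linarith [show (0 : ℤ) < 3 ^ a by positivity]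
  refine ⟨hlow, hup, ?_⟩
  -- These two functionals forbid `i`, `j` from lying both in `s.A` or both in `s.B`. The bounds on
  -- `t.C` leave only one index on each side.
  have hA := pairing_eq_zero hL hsum (fun T => ((T ∩ s.A).card : ℤ) ^ 2)
    (by
      intro i j K hij hi hj
      rw [sq_card_inter_second_difference _ hij hi hj]; split_ifs <;> norm_num)
    (by
      have h₁ : (s.A ∪ s.B ∪ s.C) ∩ s.A = s.A := by grind
      have h₂ : (s.A ∪ s.C) ∩ s.A = s.A := by grind
      have h₃ : (s.B ∪ s.C) ∩ s.A = ∅ := by grind [Finset.disjoint_left]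
      have h₄ : s.C ∩ s.A = ∅ := by grind [Finset.disjoint_left]
      simp only [h₁, h₂, h₃, h₄, Finset.card_empty]
      norm_num) ht hi hj
  have hB := pairing_eq_zero hL hsum (fun T => ((T ∩ s.B).card : ℤ) ^ 2)
    (by
      intro i j K hij hi hj
      rw [sq_card_inter_second_difference _ hij hi hj]; split_ifs <;> norm_num)
    (by
      have h₁ : (s.A ∪ s.B ∪ s.C) ∩ s.B = s.B := by grind
      have h₂ : (s.B ∪ s.C) ∩ s.B = s.B := by grind
      have h₃ : (s.A ∪ s.C) ∩ s.B = ∅ := by grind [Finset.disjoint_left]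
      have h₄ : s.C ∩ s.B = ∅ := by grind [Finset.disjoint_left]
      simp only [h₁, h₂, h₃, h₄, Finset.card_empty]
      norm_num) ht hi hj
  rw [sq_card_inter_second_difference _ hij hiK hjK] at hA hB
  have hA' : ¬ (i ∈ s.A ∧ j ∈ s.A) := fun h => by simp [h] at hA
  have hB' : ¬ (i ∈ s.B ∧ j ∈ s.B) := fun h => by simp [h] at hB
  simp only [Finset.insert_subset_iff] at hup
  have h₁ : i ∉ s.C := fun h => hiK (hlow h)
  have h₂ : j ∉ s.C := fun h => hjK (hlow h)
  have h₃ := hup.1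
  have h₄ := hup.2.1
  simp only [Finset.mem_union] at h₃ h₄
  tauto

/-! ### Marginals and implications between CI ideals. -/

section

variable {n : ℕ} {r : Fin n → ℕ}

theorem marginal_congr {S : Finset (Fin n)} {x y : JointState r} (h : ∀ i ∈ S, x i = y i) :
    marginal r S x = marginal r S y := by
  unfold marginal
  congr 1
  ext z
  simp only [Finset.mem_filter, Finset.mem_univ, true_and]
  exact forall₂_congr fun i hi => by rw [h i hi]

/-- Fixing `y` to equal `x` everywhere off `U`, not only on `S`, selects one representative of each
`T`-state, so nothing is counted twice. -/
theorem marginal_eq_sum {S U T : Finset (Fin n)} (hd : Disjoint S U) (hT : S ∪ U = T)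
    (x : JointState r) :
    marginal r S x = ∑ y : JointState r with ∀ i ∉ U, y i = x i, marginal r T y := by
  subst hT
  unfold marginal
  rw [← Finset.sum_fiberwise_of_maps_to (g := fun z : JointState r => U.piecewise z x)
    (t := Finset.univ.filter fun y : JointState r => ∀ i ∉ U, y i = x i)]
  · refine Finset.sum_congr rfl fun y hy => Finset.sum_congr ?_ fun _ _ => rfl
    simp only [Finset.mem_filter, Finset.mem_univ, true_and] at hy
    ext z
    simp only [Finset.mem_filter, Finset.mem_univ, true_and, funext_iff, Finset.piecewise]
    rw [Finset.disjoint_left] at hd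
    constructor
    · rintro ⟨h₁, h₂⟩ i hi
      have := h₂ i
      rcases Finset.mem_union.1 hi with hi | hi
      · rw [h₁ i hi, hy i (hd hi)]
      · rwa [if_pos hi] at this
    · intro h
      refine ⟨fun i hi => ?_, fun i => ?_⟩
      · rw [h i (Finset.mem_union_left _ hi), hy i (hd hi)]
      · split_ifs with hi
        · exact h i (Finset.mem_union_right _ hi)
        · exact (hy i hi).symm
  · intro z hz
    simp only [Finset.mem_filter, Finset.mem_univ, true_and]
    intro i hi
    simp [hi]

theorem marginal_mul_marginal_sub_mem (s : CIStatement n) (x y : JointState r)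
    (h : ∀ i ∈ s.C, x i = y i) :
    marginal r (s.A ∪ s.B ∪ s.C) x * marginal r (s.A ∪ s.B ∪ s.C) y
      - marginal r (s.A ∪ s.B ∪ s.C) (s.B.piecewise y x)
        * marginal r (s.A ∪ s.B ∪ s.C) (s.B.piecewise x y) ∈ ciIdeal r s :=
  Ideal.subset_span ⟨x, y, h, rfl⟩

/-- Conditional independence in product form: `p_{abc+} p_{c+} = p_{ac+} p_{bc+}`. -/
theorem marginal_mul_marginal_sub_mem_ciIdeal (s : CIStatement n) (x : JointState r) :
    marginal r (s.A ∪ s.B ∪ s.C) x * marginal r s.C x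
      - marginal r (s.A ∪ s.C) x * marginal r (s.B ∪ s.C) x ∈ ciIdeal r s := by
  have hAB := Finset.disjoint_left.1 s.disjoint_AB
  have hBC := Finset.disjoint_left.1 s.disjoint_BC
  have hd : Disjoint s.C (s.A ∪ s.B) :=
    Finset.disjoint_union_right.2 ⟨s.disjoint_AC.symm, s.disjoint_BC.symm⟩
  have hdB : Disjoint (s.A ∪ s.C) s.B :=
    Finset.disjoint_union_left.2 ⟨s.disjoint_AB, s.disjoint_BC.symm⟩
  have hdA : Disjoint (s.B ∪ s.C) s.A :=
    Finset.disjoint_union_left.2 ⟨s.disjoint_AB.symm, s.disjoint_AC.symm⟩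
  rw [marginal_eq_sum hd (Finset.union_comm _ _) x,
    marginal_eq_sum hdB (by rw [Finset.union_right_comm]) x,
    marginal_eq_sum hdA (T := s.A ∪ s.B ∪ s.C)
      (by rw [Finset.union_comm, ← Finset.union_assoc]) x,
    Finset.sum_mul_sum, ← Finset.sum_product', Finset.mul_sum]
  -- A variant of `x` in the `B`-coordinates and one in the `A`-coordinates merge into a single
  -- variant in both. After this reindexing the difference is a sum of minors.
  have hbij : ∑ p ∈ (Finset.univ.filter fun y : JointState r => ∀ i ∉ s.B, y i = x i) ×ˢ
        (Finset.univ.filter fun y : JointState r => ∀ i ∉ s.A, y i = x i),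
        marginal r (s.A ∪ s.B ∪ s.C) p.1 * marginal r (s.A ∪ s.B ∪ s.C) p.2 =
      ∑ y : JointState r with ∀ i ∉ s.A ∪ s.B, y i = x i,
        marginal r (s.A ∪ s.B ∪ s.C) (s.B.piecewise y x)
          * marginal r (s.A ∪ s.B ∪ s.C) (s.B.piecewise x y) := by
    refine Finset.sum_bij' (fun p _ => s.B.piecewise p.1 p.2)
      (fun y _ => (s.B.piecewise y x, s.B.piecewise x y)) ?_ ?_ ?_ ?_ ?_
    · simp only [Finset.mem_product, Finset.mem_filter, Finset.mem_univ, true_and,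
        Finset.mem_union, not_or]
      rintro p ⟨-, h⟩ i ⟨hA, hB⟩
      simp [hB, h i hA]
    · simp only [Finset.mem_product, Finset.mem_filter, Finset.mem_univ, true_and,
        Finset.mem_union, not_or]
      intro y h
      refine ⟨fun i hi => by simp [hi], fun i hi => ?_⟩
      by_cases hB : i ∈ s.B
      · simp [hB]
      · simp [hB, h i ⟨hi, hB⟩]
    · simp only [Finset.mem_product, Finset.mem_filter, Finset.mem_univ, true_and]
      rintro ⟨y, z⟩ ⟨hy, hz⟩
      dsimp only at hy hz
      refine Prod.ext (funext fun i => ?_) (funext fun i => ?_)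
      · by_cases hB : i ∈ s.B
        · simp [hB]
        · simp [hB, hy i hB]
      · by_cases hB : i ∈ s.B
        · simp [hB, hz i fun h => hAB h hB]
        · simp [hB]
    · intro y _
      funext i
      by_cases hB : i ∈ s.B <;> simp [hB]
    · simp only [Finset.mem_product, Finset.mem_filter, Finset.mem_univ, true_and]
      rintro ⟨y, z⟩ ⟨hy, hz⟩
      dsimp only at hy hz
      congr 2
      · funext i
        by_cases hB : i ∈ s.B
        · simp [hB]
        · simp [hB, hy i hB]
      · funext i
        by_cases hB : i ∈ s.B
        · simp [hB, hz i fun h => hAB h hB]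
        · simp [hB]
  rw [hbij, ← Finset.sum_sub_distrib]
  refine Ideal.sum_mem _ fun y hy => ?_
  simp only [Finset.mem_filter, Finset.mem_univ, true_and] at hy
  refine marginal_mul_marginal_sub_mem s x y fun i hi => (hy i ?_).symm
  exact fun h => Finset.disjoint_left.1 hd hi h

/-- The CI statement with the roles of `A` and `B` exchanged. -/
def CIStatement.swap (s : CIStatement n) : CIStatement n where
  A := s.B
  B := s.A
  C := s.C
  nonempty_A := s.nonempty_B
  nonempty_B := s.nonempty_A
  disjoint_AB := s.disjoint_AB.symm
  disjoint_AC := s.disjoint_BC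
  disjoint_BC := s.disjoint_AC

/-- For states agreeing on `C`, exchanging the `A`-coordinates is, up to irrelevant coordinates,
exchanging the `B`-coordinates and reversing the two factors. -/
theorem ciIdeal_swap_le (s : CIStatement n) : ciIdeal r s.swap ≤ ciIdeal r s := by
  refine Ideal.span_le.2 ?_
  rintro f ⟨x, y, h, rfl⟩
  have hAB := Finset.disjoint_left.1 s.disjoint_AB
  have hC : ∀ i ∈ s.C, x i = y i := h
  have key : ∀ x y : JointState r, (∀ i ∈ s.C, x i = y i) →
      marginal r (s.B ∪ s.A ∪ s.C) (s.A.piecewise y x) =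
      marginal r (s.A ∪ s.B ∪ s.C) (s.B.piecewise x y) := by
    intro x y hC
    rw [Finset.union_comm s.B]
    refine marginal_congr fun i hi => ?_
    by_cases hA : i ∈ s.A
    · simp [hA, hAB hA]
    · by_cases hB : i ∈ s.B
      · simp [hA, hB]
      · simp only [Finset.mem_union, hA, hB, false_or] at hi
        simp [hA, hB, hC i hi]
  change marginal r (s.B ∪ s.A ∪ s.C) x * marginal r (s.B ∪ s.A ∪ s.C) y
    - marginal r (s.B ∪ s.A ∪ s.C) (s.A.piecewise y x)
      * marginal r (s.B ∪ s.A ∪ s.C) (s.A.piecewise x y) ∈ ciIdeal r s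
  rw [key x y hC, key y x fun i hi => (hC i hi).symm, Finset.union_comm s.B,
    mul_comm (marginal r _ (s.B.piecewise x y))]
  exact marginal_mul_marginal_sub_mem s x y hC

/-- Decomposition and weak union: a CI statement implies the statements obtained by shrinking
`A` and `B` and moving variables from them to `C`. -/
theorem ciIdeal_le_of_subset {s t : CIStatement n} (hA : t.A ⊆ s.A) (hB : t.B ⊆ s.B)
    (hC : s.C ⊆ t.C) (hU : t.C ⊆ s.A ∪ s.B ∪ s.C) : ciIdeal r t ≤ ciIdeal r s := by
  refine Ideal.span_le.2 ?_
  rintro f ⟨x, y, h, rfl⟩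
  set T := s.A ∪ s.B ∪ s.C
  set S := t.A ∪ t.B ∪ t.C
  have hsAB := Finset.disjoint_left.1 s.disjoint_AB
  have hST : S ⊆ T := by
    intro i hi
    have := @hA i; have := @hB i; have := @hU i
    simp only [S, T, Finset.mem_union] at *
    tauto
  have hd : Disjoint S (T \ S) := Finset.disjoint_sdiff
  have e (x) := marginal_eq_sum (r := r) hd (Finset.union_sdiff_of_subset hST) x
  rw [e x, e y, e (t.B.piecewise y x), e (t.B.piecewise x y), Finset.sum_mul_sum,
    Finset.sum_mul_sum, ← Finset.sum_product', ← Finset.sum_product']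
  -- Off the summed coordinates `T \ S`, exchanging `s.B` has the effect of exchanging `t.B`: the
  -- remaining indices of `s.B` lie in `t.C`, where `x` and `y` agree.
  have swap_eq : ∀ x y u v : JointState r, (∀ i ∈ t.C, x i = y i) →
      (∀ i ∉ T \ S, u i = x i) → (∀ i ∉ T \ S, v i = y i) → ∀ i ∉ T \ S,
      s.B.piecewise v u i = t.B.piecewise y x i := by
    intro x y u v h hu hv i hi
    have hui := hu i hi
    have hvi := hv i hi
    by_cases hsB : i ∈ s.B
    · by_cases htB : i ∈ t.B
      · simp [hsB, htB, hvi]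
      · have : i ∈ t.C := by
          have := fun h => hsAB (@hA i h) hsB
          simp only [S, T, Finset.mem_union, Finset.mem_sdiff] at hi
          tauto
        simp [hsB, htB, hvi, h i this]
    · have htB : i ∉ t.B := fun h => hsB (hB h)
      simp [hsB, htB, hui]
  -- The involution exchanging the `s.B`-coordinates of `(u, v)` matches the two expansions, so a
  -- minor for `t` is a sum of minors for `s`.
  have hbij : ∑ p ∈ (Finset.univ.filter fun u : JointState r =>
          ∀ i ∉ T \ S, u i = t.B.piecewise y x i) ×ˢ
        (Finset.univ.filter fun u : JointState r => ∀ i ∉ T \ S, u i = t.B.piecewise x y i),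
        marginal r T p.1 * marginal r T p.2 =
      ∑ p ∈ (Finset.univ.filter fun u : JointState r => ∀ i ∉ T \ S, u i = x i) ×ˢ
        (Finset.univ.filter fun u : JointState r => ∀ i ∉ T \ S, u i = y i),
        marginal r T (s.B.piecewise p.2 p.1) * marginal r T (s.B.piecewise p.1 p.2) := by
    symm
    refine Finset.sum_bij' (fun p _ => (s.B.piecewise p.2 p.1, s.B.piecewise p.1 p.2))
      (fun p _ => (s.B.piecewise p.2 p.1, s.B.piecewise p.1 p.2)) ?_ ?_ ?_ ?_ ?_
    · simp only [Finset.mem_product, Finset.mem_filter, Finset.mem_univ, true_and]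
      rintro ⟨u, v⟩ ⟨hu, hv⟩
      exact ⟨swap_eq x y u v h hu hv, swap_eq y x v u (fun i hi => (h i hi).symm) hv hu⟩
    · simp only [Finset.mem_product, Finset.mem_filter, Finset.mem_univ, true_and]
      rintro ⟨u, v⟩ ⟨hu, hv⟩
      have hxy : ∀ i ∈ t.C, t.B.piecewise y x i = t.B.piecewise x y i := fun i hi => by
        by_cases hB : i ∈ t.B <;> simp [hB, h i hi]
      refine ⟨fun i hi => (swap_eq _ _ u v hxy hu hv i hi).trans ?_,
        fun i hi => (swap_eq _ _ v u (fun i hi => (hxy i hi).symm) hv hu i hi).trans ?_⟩ <;>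
      by_cases hB : i ∈ t.B <;> simp [hB]
    · rintro ⟨u, v⟩ -
      refine Prod.ext (funext fun i => ?_) (funext fun i => ?_) <;>
      by_cases hB : i ∈ s.B <;> simp [hB]
    · rintro ⟨u, v⟩ -
      refine Prod.ext (funext fun i => ?_) (funext fun i => ?_) <;>
      by_cases hB : i ∈ s.B <;> simp [hB]
    · rintro ⟨u, v⟩ -
      rfl
  rw [hbij, ← Finset.sum_sub_distrib]
  refine Ideal.sum_mem _ fun p hp => ?_
  simp only [Finset.mem_product, Finset.mem_filter, Finset.mem_univ, true_and] at hp
  refine marginal_mul_marginal_sub_mem s p.1 p.2 fun i hi => ?_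
  have hi' : i ∉ T \ S := by simp [S, hC hi]
  rw [hp.1 i hi', hp.2 i hi', h i (hC hi)]

theorem ciIdealSum_le {L : Multiset (CIStatement n)} {I : Ideal (ProbRing r)} :
    ciIdealSum r L ≤ I ↔ ∀ t ∈ L, ciIdeal r t ≤ I := by
  unfold ciIdealSum
  induction L using Multiset.induction with
  | empty => simp
  | cons t L ih => simp [ih]

theorem ciIdealSum_le_ciIdeal {L : Multiset (CIStatement n)} {s : CIStatement n}
    (hL : ∀ t ∈ L, t.IsElementary) (hsum : (L.map CIStatement.imset).sum = s.imset) :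
    ciIdealSum r L ≤ ciIdeal r s := by
  refine ciIdealSum_le.2 fun t ht => ?_
  obtain ⟨i, hi⟩ := Finset.card_eq_one.1 (hL t ht).1
  obtain ⟨j, hj⟩ := Finset.card_eq_one.1 (hL t ht).2
  obtain ⟨hlow, hup, h | h⟩ := elementary_summand_support hL hsum ht hi hj
  · refine ciIdeal_le_of_subset ?_ ?_ hlow fun k hk => hup (by simp [hk])
    · simpa [hi] using h.1
    · simpa [hj] using h.2
  · refine le_trans (ciIdeal_le_of_subset (s := s.swap) ?_ ?_ hlow fun k hk => ?_)
      (ciIdeal_swap_le s)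
    · simpa [hi, CIStatement.swap] using h.1
    · simpa [hj, CIStatement.swap] using h.2
    · have := hup (show k ∈ insert i (insert j t.C) by simp [hk])
      rwa [Finset.union_comm s.A] at this

/-! ### Multiplying CI relations along an imset identity. -/

/-- The alternating product of the marginals of `x` with exponents given by `u`. -/
noncomputable def marginalProd {K : Type*} [Field K] (m : Finset (Fin n) → K)
    (u : Finset (Fin n) → ℤ) : K := ∏ T, m T ^ u T

theorem marginalProd_add {K : Type*} [Field K] {m : Finset (Fin n) → K} (hm : ∀ T, m T ≠ 0)
    (u v : Finset (Fin n) → ℤ) :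
    marginalProd m (u + v) = marginalProd m u * marginalProd m v := by
  simp [marginalProd, zpow_add₀ (hm _), Finset.prod_mul_distrib]

theorem marginalProd_imset {K : Type*} [Field K] {m : Finset (Fin n) → K} (hm : ∀ T, m T ≠ 0)
    (s : CIStatement n) : marginalProd m s.imset =
      m (s.A ∪ s.B ∪ s.C) * m s.C / m (s.A ∪ s.C) / m (s.B ∪ s.C) := by
  have e (T U : Finset (Fin n)) : m T ^ (if T = U then 1 else 0 : ℤ) = if T = U then m T else 1 := by
    split_ifs <;> simp
  simp only [marginalProd, CIStatement.imset, zpow_sub₀ (hm _), zpow_add₀ (hm _), e,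
    Finset.prod_div_distrib, Finset.prod_mul_distrib, Finset.prod_ite_eq', Finset.mem_univ, if_true]

theorem marginalProd_sum_imset {K : Type*} [Field K] {m : Finset (Fin n) → K}
    (hm : ∀ T, m T ≠ 0) {L : Multiset (CIStatement n)}
    (h : ∀ t ∈ L, m (t.A ∪ t.B ∪ t.C) * m t.C = m (t.A ∪ t.C) * m (t.B ∪ t.C)) :
    marginalProd m (L.map CIStatement.imset).sum = 1 := by
  induction L using Multiset.induction with
  | empty => simp [marginalProd]
  | cons t L ih =>
    rw [Multiset.map_cons, Multiset.sum_cons, marginalProd_add hm,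
      ih fun t ht => h t (Multiset.mem_cons_of_mem ht), marginalProd_imset hm,
      h t (Multiset.mem_cons_self _ _)]
    have := hm (t.A ∪ t.C)
    have := hm (t.B ∪ t.C)
    field_simp

/-- A prime ideal over the CI ideals of statements whose imsets sum to that of `s`, containing no
marginal, contains the CI ideal of `s`. -/
theorem ciIdeal_le_of_isPrime {L : Multiset (CIStatement n)} {s : CIStatement n}
    (hsum : (L.map CIStatement.imset).sum = s.imset) {P : Ideal (ProbRing r)} [P.IsPrime]
    (hP : ciIdealSum r L ≤ P) (hmarg : ∀ T x, marginal r T x ∉ P) : ciIdeal r s ≤ P := by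
  let φ : ProbRing r →+* FractionRing (ProbRing r ⧸ P) :=
    (algebraMap _ _).comp (Ideal.Quotient.mk P)
  have hφ (f : ProbRing r) : φ f = 0 ↔ f ∈ P := by
    simp [φ, Ideal.Quotient.eq_zero_iff_mem]
  have hne (x : JointState r) (T) : φ (marginal r T x) ≠ 0 := fun h => hmarg T x ((hφ _).1 h)
  have hfac (x : JointState r) : φ (marginal r (s.A ∪ s.B ∪ s.C) x) * φ (marginal r s.C x) =
      φ (marginal r (s.A ∪ s.C) x) * φ (marginal r (s.B ∪ s.C) x) := by
    have h1 := marginalProd_sum_imset (m := fun T => φ (marginal r T x)) (hne x) (L := L) (by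
      intro t ht
      have := (hφ _).2 (ciIdealSum_le.1 hP t ht (marginal_mul_marginal_sub_mem_ciIdeal t x))
      rwa [map_sub, map_mul, map_mul, sub_eq_zero] at this)
    rw [hsum, marginalProd_imset (hne x)] at h1
    have := hne x (s.A ∪ s.C)
    have := hne x (s.B ∪ s.C)
    field_simp at h1
    exact h1
  refine Ideal.span_le.2 ?_
  rintro f ⟨x, y, h, rfl⟩
  have hAB := Finset.disjoint_left.1 s.disjoint_AB
  have hBC := Finset.disjoint_right.1 s.disjoint_BC
  have hCm : ∀ {z : JointState r}, (∀ i ∈ s.C, z i = x i) → marginal r s.C z = marginal r s.C x :=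
    fun h => marginal_congr h
  have hA' (x y : JointState r) :
      marginal r (s.A ∪ s.C) (s.B.piecewise y x) = marginal r (s.A ∪ s.C) x :=
    marginal_congr fun i hi => by
      have : i ∉ s.B := by
        rcases Finset.mem_union.1 hi with hi | hi
        exacts [hAB hi, hBC hi]
      simp [this]
  have hB' (x y : JointState r) (h : ∀ i ∈ s.C, x i = y i) :
      marginal r (s.B ∪ s.C) (s.B.piecewise y x) = marginal r (s.B ∪ s.C) y :=
    marginal_congr fun i hi => by
      by_cases hB : i ∈ s.B
      · simp [hB]
      · simp only [Finset.mem_union, hB, false_or] at hi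
        simp [hB, h i hi]
  have h' : ∀ i ∈ s.C, y i = x i := fun i hi => (h i hi).symm
  have hx := hfac x
  have hy := hfac y
  have hxy := hfac (s.B.piecewise y x)
  have hyx := hfac (s.B.piecewise x y)
  rw [hA' x y, hB' x y h, hCm fun i hi => by simp [hBC hi]] at hxy
  rw [hA' y x, hB' y x h', hCm fun i hi => by simp [hBC hi, h' i hi]] at hyx
  rw [hCm h'] at hy
  refine (hφ _).1 ?_
  rw [map_sub, map_mul, map_mul]
  have hc := hne x s.C
  -- After multiplication by `p_{c+}²`, both terms of the minor equal `p_{ac+} p_{a'c+} p_{bc+}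
  -- p_{b'c+}`.
  refine mul_left_cancel₀ (mul_ne_zero hc hc) ?_
  linear_combination (φ (marginal r (s.A ∪ s.B ∪ s.C) y) * φ (marginal r s.C x)) * hx
    + (φ (marginal r (s.A ∪ s.C) x) * φ (marginal r (s.B ∪ s.C) x)) * hy
    - (φ (marginal r (s.A ∪ s.B ∪ s.C) (s.B.piecewise x y)) * φ (marginal r s.C x)) * hxy
    - (φ (marginal r (s.A ∪ s.C) x) * φ (marginal r (s.B ∪ s.C) y)) * hyx

/-! ### Primality of CI ideals. -/

open scoped Classical in
/-- A coordinate map for the Segre-type parametrization of a CI model: on joint states that agree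
with the reference state `o` outside `T` it forgets the coordinates in `D`, and it is
the identity elsewhere. -/
noncomputable def forget (o : JointState r) (T D : Finset (Fin n)) (y : JointState r) :
    JointState r := if ∀ i ∉ T, y i = o i then D.piecewise o y else y

theorem forget_of_agree {o : JointState r} {T : Finset (Fin n)} (D : Finset (Fin n))
    {y : JointState r} (h : ∀ i ∉ T, y i = o i) : forget o T D y = D.piecewise o y := if_pos h

theorem forget_of_not_agree {o : JointState r} {T : Finset (Fin n)} (D : Finset (Fin n))
    {y : JointState r} (h : ¬ ∀ i ∉ T, y i = o i) : forget o T D y = y := if_neg h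

theorem agree_of_forget_eq {o : JointState r} {T D : Finset (Fin n)} (hD : D ⊆ T)
    {x y : JointState r} (hx : ∀ i ∉ T, x i = o i) (h : forget o T D y = forget o T D x) :
    ∀ i ∉ T, y i = o i := by
  by_contra hy
  rw [forget_of_not_agree D hy, forget_of_agree D hx] at h
  refine hy fun i hi => ?_
  have hiD : i ∉ D := fun h => hi (hD h)
  simp [h, hiD, hx i hi]

theorem agree_iff_of_forget_eq {o : JointState r} {T D : Finset (Fin n)} (hD : D ⊆ T)
    {x y : JointState r} (h : forget o T D y = forget o T D x) :
    (∀ i ∉ T, y i = o i) ↔ ∀ i ∉ T, x i = o i :=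
  ⟨fun hy => agree_of_forget_eq hD hy h.symm, fun hx => agree_of_forget_eq hD hx h⟩

/-- States agreeing with `o` off `T` label the `T`-marginals; `ψ` is the linear change of
coordinates putting those marginals in place of the corresponding variables. In the new coordinates
the ideal is the kernel of `Θ`, whose factors record `(a, c)` and `(b, c)` on these states; every
other state gets its own pair of variables. The target is a domain, so the kernel is prime. -/
theorem ciIdeal_isPrime [Nonempty (JointState r)] (s : CIStatement n) :
    (ciIdeal r s).IsPrime := by
  classical
  obtain ⟨o⟩ := ‹Nonempty (JointState r)›
  have hAB := Finset.disjoint_left.1 s.disjoint_AB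
  have hAC := Finset.disjoint_right.1 s.disjoint_AC
  have hBC := Finset.disjoint_right.1 s.disjoint_BC
  set T := s.A ∪ s.B ∪ s.C
  have hAT : s.A ⊆ T := fun i hi => by simp [T, hi]
  have hBT : s.B ⊆ T := fun i hi => by simp [T, hi]
  let α := forget o T s.B
  let β := forget o T s.A
  let Θ : JointState r → MvPolynomial (JointState r ⊕ JointState r) ℝ :=
    fun y => X (Sum.inl (α y)) * X (Sum.inr (β y))
  let ψ : ProbRing r →ₐ[ℝ] ProbRing r :=
    aeval fun y => if ∀ i ∉ T, y i = o i then marginal r T y else X y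
  -- `Θ` composed with the inverse of `ψ`: the variable of a labelling state is its marginal minus
  -- the other variables of the fibre, which `ψ` fixes.
  let φ : ProbRing r →ₐ[ℝ] MvPolynomial (JointState r ⊕ JointState r) ℝ :=
    aeval fun y => if ∀ i ∉ T, y i = o i then
      Θ y - ∑ z ∈ (Finset.univ.filter fun z : JointState r => ∀ i ∈ T, z i = y i).erase y, Θ z
      else Θ y
  have hψ₁ {y : JointState r} (h : ∀ i ∉ T, y i = o i) : ψ (X y) = marginal r T y := by
    simp only [ψ, aeval_X]; exact if_pos h
  have hψ₂ {y : JointState r} (h : ¬ ∀ i ∉ T, y i = o i) : ψ (X y) = X y := by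
    simp only [ψ, aeval_X]; exact if_neg h
  have hφ₁ {y : JointState r} (h : ∀ i ∉ T, y i = o i) : φ (X y) = Θ y -
      ∑ z ∈ (Finset.univ.filter fun z : JointState r => ∀ i ∈ T, z i = y i).erase y, Θ z := by
    simp only [φ, aeval_X]; exact if_pos h
  have hφ₂ {y : JointState r} (h : ¬ ∀ i ∉ T, y i = o i) : φ (X y) = Θ y := by
    simp only [φ, aeval_X]; exact if_neg h
  have not_agree {y z : JointState r} (hy : ∀ i ∉ T, y i = o i)
      (hz : z ∈ (Finset.univ.filter fun z : JointState r => ∀ i ∈ T, z i = y i).erase y) :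
      ¬ ∀ i ∉ T, z i = o i := by
    intro h
    simp only [Finset.mem_erase, Finset.mem_filter, Finset.mem_univ, true_and] at hz
    refine hz.1 (funext fun i => ?_)
    by_cases hi : i ∈ T
    · exact hz.2 i hi
    · rw [h i hi, hy i hi]
  have marg_eq (y : JointState r) : marginal r T y = X y +
      ∑ z ∈ (Finset.univ.filter fun z : JointState r => ∀ i ∈ T, z i = y i).erase y, X z := by
    rw [Finset.add_sum_erase _ _ (by simp)]; rfl
  have hφm {y : JointState r} (h : ∀ i ∉ T, y i = o i) : φ (marginal r T y) = Θ y := by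
    rw [marg_eq, map_add, map_sum, hφ₁ h, Finset.sum_congr rfl fun z hz => hφ₂ (not_agree h hz)]
    ring
  have hφψ (f) : φ (ψ f) = aeval Θ f := by
    have : φ.comp ψ = aeval Θ := by
      refine MvPolynomial.algHom_ext fun y => ?_
      rw [AlgHom.comp_apply, aeval_X (R := ℝ) Θ]
      by_cases h : ∀ i ∉ T, y i = o i
      · rw [hψ₁ h, hφm h]
      · rw [hψ₂ h, hφ₂ h]
    exact DFunLike.congr_fun this f
  have hsurj : Function.Surjective ψ := by
    have hX (y : JointState r) : X y ∈ ψ.range := by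
      by_cases h : ∀ i ∉ T, y i = o i
      · rw [← add_sub_cancel_right (X y) (∑ z ∈ (Finset.univ.filter
          fun z : JointState r => ∀ i ∈ T, z i = y i).erase y, X z), ← marg_eq]
        exact sub_mem ⟨X y, hψ₁ h⟩ (sum_mem fun z hz => ⟨X z, hψ₂ (not_agree h hz)⟩)
      · exact ⟨X y, hψ₂ h⟩
    rw [← AlgHom.range_eq_top, eq_top_iff, ← adjoin_range_X]
    exact Algebra.adjoin_le (by rintro _ ⟨y, rfl⟩; exact hX y)
  have hα {x y : JointState r} (hx : ∀ i ∉ T, x i = o i) (hy : ∀ i ∉ T, y i = o i) :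
      (∀ i ∉ T, s.B.piecewise y x i = o i) ∧ α (s.B.piecewise y x) = α x := by
    have h : ∀ i ∉ T, s.B.piecewise y x i = o i := fun i hi => by
      by_cases hB : i ∈ s.B <;> simp [hB, hx i hi, hy i hi]
    refine ⟨h, ?_⟩
    simp only [α]
    rw [forget_of_agree _ h, forget_of_agree _ hx]
    funext i
    by_cases hB : i ∈ s.B <;> simp [hB]
  have hβ {x y : JointState r} (hx : ∀ i ∉ T, x i = o i) (hy : ∀ i ∉ T, y i = o i)
      (hC : ∀ i ∈ s.C, x i = y i) : β (s.B.piecewise y x) = β y := by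
    simp only [β]
    rw [forget_of_agree _ (hα hx hy).1, forget_of_agree _ hy]
    funext i
    by_cases hA : i ∈ s.A
    · simp [hA]
    by_cases hB : i ∈ s.B
    · simp [hA, hB]
    by_cases hi : i ∈ s.C
    · simp [hA, hB, hC i hi]
    · have hT : i ∉ T := by simp [T, hA, hB, hi]
      simp [hA, hB, hx i hT, hy i hT]
  have hker : ciIdeal r s = RingHom.ker φ := by
    refine le_antisymm (Ideal.span_le.2 ?_) fun f hf => ?_
    · rintro _ ⟨x, y, h, rfl⟩
      have hb (x : JointState r) : ∀ i ∉ T, T.piecewise x o i = o i := fun i hi => by simp [hi]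
      have hm (x : JointState r) : marginal r T x = marginal r T (T.piecewise x o) :=
        marginal_congr fun i hi => by simp [hi]
      have hm' (x y : JointState r) : marginal r T (s.B.piecewise y x) =
          marginal r T (s.B.piecewise (T.piecewise y o) (T.piecewise x o)) :=
        marginal_congr fun i hi => by by_cases hB : i ∈ s.B <;> simp [hi, hB]
      have hC : ∀ i ∈ s.C, T.piecewise x o i = T.piecewise y o i := fun i hi => by
        have hi' : i ∈ T := by simp [T, hi]
        simp [hi', h i hi]
      have hC' := fun i hi => (hC i hi).symm
      rw [SetLike.mem_coe, RingHom.mem_ker, hm x, hm y, hm' x y, hm' y x]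
      have hx' := hb x
      have hy' := hb y
      rw [map_sub, map_mul, map_mul, hφm hx', hφm hy', hφm (hα hx' hy').1, hφm (hα hy' hx').1]
      simp only [Θ]
      rw [(hα hx' hy').2, (hα hy' hx').2, hβ hx' hy' hC, hβ hy' hx' hC']
      ring
    · obtain ⟨g, rfl⟩ := hsurj f
      rw [RingHom.mem_ker, hφψ] at hf
      refine Ideal.mem_comap.1 (ker_segre_le_of_swap (α := α) (β := β)
        (I := (ciIdeal r s).comap ψ) ?_ ?_ hf)
      · intro x y h₁ h₂
        by_cases hy : ∀ i ∉ T, y i = o i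
        · have hx := agree_of_forget_eq hBT hy h₁
          simp only [α, β] at h₁ h₂
          rw [forget_of_agree _ hx, forget_of_agree _ hy] at h₁ h₂
          funext i
          by_cases hB : i ∈ s.B
          · have hA : i ∉ s.A := fun h => hAB h hB
            simpa [hA] using congrFun h₂ i
          · simpa [hB] using congrFun h₁ i
        · have hx := mt (agree_iff_of_forget_eq hBT h₁).1 hy
          simpa only [α, forget_of_not_agree _ hx, forget_of_not_agree _ hy] using h₁
      · intro x y z h₁ h₂
        by_cases hx : ∀ i ∉ T, x i = o i
        · have hy := agree_of_forget_eq hBT hx h₁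
          have hz := agree_of_forget_eq hAT hx h₂
          simp only [α, β] at h₁ h₂
          rw [forget_of_agree _ hx] at h₁ h₂
          rw [forget_of_agree _ hy] at h₁
          rw [forget_of_agree _ hz] at h₂
          have hyx : ∀ i ∉ s.B, y i = x i := fun i hi => by simpa [hi] using congrFun h₁ i
          have hzx : ∀ i ∉ s.A, z i = x i := fun i hi => by simpa [hi] using congrFun h₂ i
          have hzy : ∀ i ∈ s.C, z i = y i := fun i hi => by
            rw [hzx i (hAC hi), hyx i (hBC hi)]
          -- `y` differs from `x` only in `B` and `z` only in `A`, so `x` takes `B` from `z` and the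
          -- rest from `y`; the fourth corner `w` does the opposite.
          refine ⟨s.B.piecewise y z, (hα hz hy).2, hβ hz hy hzy, ?_⟩
          have hx' : x = s.B.piecewise z y := by
            funext i
            by_cases hB : i ∈ s.B
            · simp [hB, hzx i fun h => hAB h hB]
            · simp [hB, hyx i hB]
          rw [Ideal.mem_comap, map_sub, map_mul, map_mul, hψ₁ hx, hψ₁ hy, hψ₁ hz,
            hψ₁ (hα hz hy).1, hx']
          exact marginal_mul_marginal_sub_mem s y z fun i hi => (hzy i hi).symm
        · have hy := mt (agree_iff_of_forget_eq hBT h₁).1 hx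
          have hz := mt (agree_iff_of_forget_eq hAT h₂).1 hx
          simp only [α, β] at h₁ h₂
          rw [forget_of_not_agree _ hx] at h₁ h₂
          rw [forget_of_not_agree _ hy] at h₁
          rw [forget_of_not_agree _ hz] at h₂
          subst h₁ h₂
          exact ⟨z, rfl, rfl, by simp⟩
  rw [hker]
  exact RingHom.ker_isPrime φ

/-! ### Positive distributions and minimal primes. -/

/-- The count is independent of `x`, so at a constant point all marginals over the same `T` coincide
and every minor vanishes. -/
theorem card_agree (T : Finset (Fin n)) (x : JointState r) :
    (Finset.univ.filter fun y : JointState r => ∀ i ∈ T, y i = x i).card =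
      ∏ i, if i ∈ T then 1 else r i := by
  have : (Finset.univ.filter fun y : JointState r => ∀ i ∈ T, y i = x i) =
      Fintype.piFinset fun i => if i ∈ T then {x i} else Finset.univ := by
    ext y
    simp only [Finset.mem_filter, Finset.mem_univ, true_and, Fintype.mem_piFinset]
    refine forall_congr' fun i => ?_
    split_ifs with h <;> simp [h]
  rw [this, Fintype.card_piFinset]
  refine Finset.prod_congr rfl fun i _ => ?_
  split_ifs <;> simp

theorem aeval_marginal_pos {p : JointState r → ℝ} (hp : ∀ x, 0 < p x) (T : Finset (Fin n))
    (x : JointState r) : 0 < aeval p (marginal r T x) := by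
  simp only [marginal, map_sum, aeval_X]
  exact Finset.sum_pos (fun y _ => hp y) ⟨x, by simp⟩

theorem uniform_mem_zeroLocus_ciIdeal (s : CIStatement n) (c : ℝ) :
    (fun _ => c) ∈ zeroLocus ℝ (ciIdeal r s) := by
  have h : ciIdeal r s ≤ RingHom.ker (aeval (fun _ : JointState r => c)) := by
    refine Ideal.span_le.2 ?_
    rintro _ ⟨x, y, -, rfl⟩
    simp only [SetLike.mem_coe, RingHom.mem_ker, marginal, map_sub, map_mul, map_sum, aeval_X,
      Finset.sum_const, card_agree, sub_self]
  exact mem_zeroLocus_iff.2 fun f hf => h hf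

theorem meetsSimplexNontrivially_ciIdeal [Nonempty (JointState r)] (s : CIStatement n) :
    MeetsSimplexNontrivially (zeroLocus ℝ (ciIdeal r s)) := by
  have hpos : (0 : ℝ) < (Fintype.card (JointState r) : ℝ)⁻¹ :=
    inv_pos.2 (Nat.cast_pos.2 Fintype.card_pos)
  refine ⟨_, uniform_mem_zeroLocus_ciIdeal s (Fintype.card (JointState r) : ℝ)⁻¹,
    ⟨fun _ => hpos.le, ?_⟩, fun _ => hpos⟩
  rw [Finset.sum_const, Finset.card_univ, nsmul_eq_mul]
  exact mul_inv_cancel₀ (inv_pos.1 hpos).ne'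

theorem marginal_notMem_of_meets {P : Ideal (ProbRing r)}
    (hP : MeetsSimplexNontrivially (zeroLocus ℝ P)) (T : Finset (Fin n)) (x : JointState r) :
    marginal r T x ∉ P := by
  obtain ⟨p, hpP, -, hp⟩ := hP
  exact fun h => (aeval_marginal_pos hp T x).ne' (mem_zeroLocus_iff.1 hpP _ h)

theorem ciIdeal_mem_minimalPrimes [Nonempty (JointState r)] {L : Multiset (CIStatement n)}
    {s : CIStatement n} (hL : ∀ t ∈ L, t.IsElementary)
    (hsum : (L.map CIStatement.imset).sum = s.imset) :
    ciIdeal r s ∈ (ciIdealSum r L).minimalPrimes := by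
  refine ⟨⟨ciIdeal_isPrime s, ciIdealSum_le_ciIdeal hL hsum⟩, fun Q hQ hQs => ?_⟩
  have := hQ.1
  -- A marginal in `Q` would lie in the larger ideal `ciIdeal r s`, which vanishes at the uniform
  -- distribution.
  exact ciIdeal_le_of_isPrime hsum hQ.2 fun T x h =>
    marginal_notMem_of_meets (meetsSimplexNontrivially_ciIdeal s) T x (hQs h)

theorem eq_ciIdeal_of_mem_minimalPrimes [Nonempty (JointState r)] {L : Multiset (CIStatement n)}
    {s : CIStatement n} (hL : ∀ t ∈ L, t.IsElementary)
    (hsum : (L.map CIStatement.imset).sum = s.imset) {P : Ideal (ProbRing r)}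
    (hP : P ∈ (ciIdealSum r L).minimalPrimes)
    (hmeets : MeetsSimplexNontrivially (zeroLocus ℝ P)) : P = ciIdeal r s := by
  have := hP.1.1
  have h := ciIdeal_le_of_isPrime hsum hP.1.2 (marginal_notMem_of_meets hmeets)
  exact le_antisymm (hP.2 ⟨ciIdeal_isPrime s, ciIdealSum_le_ciIdeal hL hsum⟩ h) h

end

theorem proposition3 (n : ℕ) (hn : n = 3 ∨ n = 4) (r : Fin n → ℕ)
    (hr : ∀ i, r i = 2 ∨ r i = 3) (hr₂ : ∃ i, r i = 2)
    (L₁ L₂ : Multiset (CIStatement n)) (s : CIStatement n)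
    (hrel : IsThreeSidedCIRelation L₁ L₂ s) :
    ciIdeal r s ∈ (ciIdealSum r L₁).minimalPrimes ∧
    ciIdeal r s ∈ (ciIdealSum r L₂).minimalPrimes ∧
    MeetsSimplexNontrivially (MvPolynomial.zeroLocus ℝ (ciIdeal r s)) ∧
    (∀ P ∈ (ciIdealSum r L₁).minimalPrimes ∪ (ciIdealSum r L₂).minimalPrimes,
      MeetsSimplexNontrivially (MvPolynomial.zeroLocus ℝ P) → P = ciIdeal r s) := by
  have : Nonempty (JointState r) :=
    ⟨fun i => ⟨0, by rcases hr i with h | h <;> omega⟩⟩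
  refine ⟨ciIdeal_mem_minimalPrimes hrel.elementary_left hrel.sum_left,
    ciIdeal_mem_minimalPrimes hrel.elementary_right hrel.sum_right,
    meetsSimplexNontrivially_ciIdeal s, ?_⟩
  rintro P (hP | hP) hmeets
  · exact eq_ciIdeal_of_mem_minimalPrimes hrel.elementary_left hrel.sum_left hP hmeets
  · exact eq_ciIdeal_of_mem_minimalPrimes hrel.elementary_right hrel.sum_right hP hmeets
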